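/- Let $A$ be a ring with subring $B$. The extension is \emph{depth two} (D2) if $A\otimes_B A$ is isomorphic to a direct summand of a finite direct sum of copies of $A$, both as a $B$-$A$-bimodule and as an $A$-$B$-bimodule. Let $R=\{r\in A: rb=br\ \forall b\in B\}$, let $S=\mathrm{End}({}_BA_B)$, and let $T=(A\otimes_B A)^B$ be the group of $t=t^1\otimes t^2$ (summation suppressed) with $bt=tb$ for all $b\in B$. The ring structure of $T$ is $tt'=t'^1t^1\otimes t^2t'^2$, $1_T=1\otimes 1$, and its $R$-bimodule structure is $r\cdot t\cdot r'=rt^1\otimes t^2r'$. A right D2 quasibase consists of finitely many $\gamma_j\in S$, $u_j\in T$ with $a\otimes a'=\sum_j a\gamma_j(a')u_j$ for all $a,a'\in A$; for such a quasibase put $$\rho(a)=a_{(0)}\otimes a_{(1)}=\sum_j\gamma_j(a)\otimes u_j\in A\otimes_R T,\qquad \Delta_T(t)=t_{(1)}\otimes t_{(2)}=\sum_j\bigl(t^1\otimes\gamma_j(t^2)\bigr)\otimes u_j\in T\otimes_R T,\qquad \varepsilon_T(t)=t^1t^2\in R .$$ \textbf{Theorem.} Let $A\,\|\,B$ be a D2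 extension. Then right D2 quasibases exist, and the left $A$-module $\mathcal C=A\otimes_R T$, $a\cdot(a'\otimes t)=aa'\otimes t$, carries an $A$-coring structure given, for every right D2 quasibase, by $$(a\otimes t)\cdot a'=aa'_{(0)}\otimes ta'_{(1)},\qquad \Delta_{\mathcal C}(a\otimes t)=(a\otimes t_{(1)})\otimes_A(1\otimes t_{(2)}),\qquad \varepsilon_{\mathcal C}(a\otimes t)=a\,\varepsilon_T(t).$$ The element $x=1_A\otimes 1_T$ is grouplike. Let $A^{\mathrm{co}\,\mathcal C}=\{a\in A: ax=xa\}$ be the coinvariants. Then $B\subseteq A^{\mathrm{co}\,\mathcal C}$, and the map $\mathrm{can}:A\otimes_B A\to\mathcal C$, $a\otimes a'\mapsto axa'$, is an isomorphism of $A$-corings from the Sweedler coring $A\otimes_B A$ (with $\Delta(a\otimes a')=(a\otimes 1)\otimes_A(1\otimes a')$ and $\varepsilon(a\otimes a')=aa'$). Moreover $(\mathcal C,x)$ is a Galois $A$-coring: $a\otimes a'\mapsto axa'$ is also an isomorphism of corings from the Sweedler coring of $A$ over $A^{\mathrm{co}\,\mathcal C}$ to $\mathcal C$. If in addition the right $B$-module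 $A_B$ is balanced (every endomorphism of $A$ as a left $\mathrm{End}(A_B)$-module is right multiplication by an element of $B$) or faithfully flat, then $A^{\mathrm{co}\,\mathcal C}=B$. -/

import Mathlib

open scoped TensorProduct

universe u v w z

/-! ### Tensor products over noncommutative rings

A right `R`-module is a `Module Rᵐᵒᵖ M`; for `m · r` we write `MulOpposite.op r • m`.
An `R`-`S`-bimodule is a left `R`-module and right `S`-module with `SMulCommClass R Sᵐᵒᵖ M`. -/

section Tensor

/-- The subgroup of `M ⊗[ℤ] N` generated by all `(m · r) ⊗ n - m ⊗ (r · n)`. -/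
def balancingSubgroup (R : Type*) (M : Type*) (N : Type*) [Ring R] [AddCommGroup M]
    [Module Rᵐᵒᵖ M] [AddCommGroup N] [Module R N] : AddSubgroup (M ⊗[ℤ] N) :=
  AddSubgroup.closure
    {x | ∃ (r : R) (m : M) (n : N), x = (MulOpposite.op r • m) ⊗ₜ[ℤ] n - m ⊗ₜ[ℤ] (r • n)}

/-- The tensor product `M ⊗_R N` of a right `R`-module and a left `R`-module, `R` any ring. -/
def BTensor (R : Type*) (M : Type*) (N : Type*) [Ring R] [AddCommGroup M]
    [Module Rᵐᵒᵖ M] [AddCommGroup N] [Module R N] : Type _ :=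
  (M ⊗[ℤ] N) ⧸ balancingSubgroup R M N

namespace BTensor

variable {R : Type*} {M N P M' N' : Type*} [Ring R]
  [AddCommGroup M] [Module Rᵐᵒᵖ M] [AddCommGroup N] [Module R N] [AddCommGroup P]
  [AddCommGroup M'] [Module Rᵐᵒᵖ M'] [AddCommGroup N'] [Module R N']

instance : AddCommGroup (BTensor R M N) :=
  inferInstanceAs (AddCommGroup ((M ⊗[ℤ] N) ⧸ balancingSubgroup R M N))

variable (R) in
/-- The simple tensor `m ⊗ n` in `M ⊗_R N`. -/
def tmul (m : M) (n : N) : BTensor R M N :=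
  QuotientAddGroup.mk' (balancingSubgroup R M N) (m ⊗ₜ[ℤ] n)

theorem add_tmul (m m' : M) (n : N) : tmul R (m + m') n = tmul R m n + tmul R m' n := by
  simp only [tmul, TensorProduct.add_tmul, map_add]; rfl

theorem tmul_add (m : M) (n n' : N) : tmul R m (n + n') = tmul R m n + tmul R m n' := by
  simp only [tmul, TensorProduct.tmul_add, map_add]; rfl

theorem zero_tmul (n : N) : tmul R (0 : M) n = 0 := by
  simp only [tmul, TensorProduct.zero_tmul, map_zero]; rfl

theorem tmul_zero (m : M) : tmul R m (0 : N) = 0 := by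
  simp only [tmul, TensorProduct.tmul_zero, map_zero]; rfl

theorem op_smul_tmul (r : R) (m : M) (n : N) :
    tmul R (MulOpposite.op r • m) n = tmul R m (r • n) := by
  have h : (MulOpposite.op r • m) ⊗ₜ[ℤ] n - m ⊗ₜ[ℤ] (r • n) ∈ balancingSubgroup R M N :=
    AddSubgroup.subset_closure ⟨r, m, n, rfl⟩
  have h2 := (QuotientAddGroup.eq_zero_iff (N := balancingSubgroup R M N) _).2 h
  exact sub_eq_zero.1 h2

theorem induction_on {p : BTensor R M N → Prop} (x : BTensor R M N) (zero : p 0)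
    (tmul : ∀ m n, p (tmul R m n)) (add : ∀ x y, p x → p y → p (x + y)) : p x := by
  obtain ⟨y, rfl⟩ := QuotientAddGroup.mk'_surjective (balancingSubgroup R M N) x
  induction y using TensorProduct.induction_on with
  | zero => exact zero
  | tmul m n => exact tmul m n
  | add a b ha hb => exact add _ _ ha hb

/-- The universal property: an `R`-balanced biadditive map factors through `M ⊗_R N`. -/
def lift (f : M →+ N →+ P) (hf : ∀ (r : R) m n, f (MulOpposite.op r • m) n = f m (r • n)) :
    BTensor R M N →+ P :=
  QuotientAddGroup.lift (balancingSubgroup R M N)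
    (TensorProduct.liftAddHom f (fun k m n => by simp))
    (by
      refine (AddSubgroup.closure_le _).2 ?_
      rintro _ ⟨r, m, n, rfl⟩
      simp [hf])

@[simp] theorem lift_tmul (f : M →+ N →+ P)
    (hf : ∀ (r : R) m n, f (MulOpposite.op r • m) n = f m (r • n)) (m : M) (n : N) :
    lift f hf (tmul R m n) = f m n := rfl

theorem hom_ext {f g : BTensor R M N →+ P} (h : ∀ m n, f (tmul R m n) = g (tmul R m n)) :
    f = g := by
  ext x
  induction x using induction_on with
  | zero => simp
  | tmul m n => exact h m n
  | add x y hx hy => simp [hx, hy]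

variable (R M N) in
/-- The biadditive map `(m, n) ↦ m ⊗ n`. -/
def mk : M →+ N →+ BTensor R M N :=
  AddMonoidHom.mk' (fun m => AddMonoidHom.mk' (fun n => tmul R m n) (tmul_add m))
    (fun m m' => by ext n; exact add_tmul m m' n)

@[simp] theorem mk_apply (m : M) (n : N) : mk R M N m n = tmul R m n := rfl

/-- The map `f ⊗ g : M ⊗_R N → M' ⊗_R N'` for `R`-linear `f` and `g`. -/
def map (f : M →+ M') (hf : ∀ (r : R) m, f (MulOpposite.op r • m) = MulOpposite.op r • f m)
    (g : N →+ N') (hg : ∀ (r : R) n, g (r • n) = r • g n) : BTensor R M N →+ BTensor R M' N' :=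
  lift (((mk R M' N').compl₂ g).comp f) (fun r m n => by
    simp [hf, hg, op_smul_tmul])

@[simp] theorem map_tmul (f : M →+ M')
    (hf : ∀ (r : R) m, f (MulOpposite.op r • m) = MulOpposite.op r • f m)
    (g : N →+ N') (hg : ∀ (r : R) n, g (r • n) = r • g n) (m : M) (n : N) :
    map f hf g hg (tmul R m n) = tmul R (f m) (g n) := rfl

section Left

variable {S : Type*} [Ring S] [Module S M] [SMulCommClass S Rᵐᵒᵖ M]

instance : SMul S (BTensor R M N) where
  smul s := map (DistribSMul.toAddMonoidHom M s) (fun r m => by simp [smul_comm])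
    (AddMonoidHom.id N) (fun _ _ => rfl)

@[simp] theorem smul_tmul (s : S) (m : M) (n : N) : s • tmul R m n = tmul R (s • m) n := rfl

theorem smul_add' (s : S) (x y : BTensor R M N) : s • (x + y) = s • x + s • y :=
  map_add (map (DistribSMul.toAddMonoidHom M s) (fun r m => by simp [smul_comm])
    (AddMonoidHom.id N) (fun _ _ => rfl)) x y

theorem smul_zero' (s : S) : s • (0 : BTensor R M N) = 0 :=
  map_zero (map (DistribSMul.toAddMonoidHom M s) (fun r m => by simp [smul_comm])
    (AddMonoidHom.id N) (fun _ _ => rfl))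

/-- If `M` is an `S`-`R`-bimodule, then `M ⊗_R N` is a left `S`-module: `s(m ⊗ n) = sm ⊗ n`. -/
instance leftModule : Module S (BTensor R M N) where
  smul_add := smul_add'
  smul_zero := smul_zero'
  one_smul x := by
    induction x using induction_on with
    | zero => exact smul_zero' _
    | tmul m n => simp
    | add x y hx hy => rw [smul_add', hx, hy]
  mul_smul s t x := by
    induction x using induction_on with
    | zero => simp only [smul_zero']
    | tmul m n => simp [mul_smul]
    | add x y hx hy => simp only [smul_add', hx, hy]
  add_smul s t x := by
    induction x using induction_on with
    | zero => simp only [smul_zero', add_zero]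
    | tmul m n => simp [add_smul, add_tmul]
    | add x y hx hy => simp only [smul_add', hx, hy]; abel
  zero_smul x := by
    induction x using induction_on with
    | zero => exact smul_zero' _
    | tmul m n => simp [zero_tmul]
    | add x y hx hy => rw [smul_add', hx, hy, add_zero]

end Left

section Right

variable {S : Type*} [Ring S] [Module Sᵐᵒᵖ N] [SMulCommClass R Sᵐᵒᵖ N]

instance rightSMul : SMul Sᵐᵒᵖ (BTensor R M N) where
  smul s := map (AddMonoidHom.id M) (fun _ _ => rfl)
    (DistribSMul.toAddMonoidHom N s) (fun r m => by simp [smul_comm])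

@[simp] theorem right_smul_tmul (s : Sᵐᵒᵖ) (m : M) (n : N) :
    s • tmul R m n = tmul R m (s • n) := rfl

theorem right_smul_add (s : Sᵐᵒᵖ) (x y : BTensor R M N) : s • (x + y) = s • x + s • y :=
  map_add (map (AddMonoidHom.id M) (fun _ _ => rfl)
    (DistribSMul.toAddMonoidHom N s) (fun r m => by simp [smul_comm])) x y

theorem right_smul_zero (s : Sᵐᵒᵖ) : s • (0 : BTensor R M N) = 0 :=
  map_zero (map (AddMonoidHom.id M) (fun _ _ => rfl)
    (DistribSMul.toAddMonoidHom N s) (fun r m => by simp [smul_comm]))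

/-- If `N` is an `R`-`S`-bimodule, then `M ⊗_R N` is a right `S`-module: `(m ⊗ n)s = m ⊗ ns`. -/
instance rightModule : Module Sᵐᵒᵖ (BTensor R M N) where
  smul_add := right_smul_add
  smul_zero := right_smul_zero
  one_smul x := by
    induction x using induction_on with
    | zero => exact right_smul_zero _
    | tmul m n => simp
    | add x y hx hy => rw [right_smul_add, hx, hy]
  mul_smul s t x := by
    induction x using induction_on with
    | zero => simp only [right_smul_zero]
    | tmul m n => simp [mul_smul]
    | add x y hx hy => simp only [right_smul_add, hx, hy]
  add_smul s t x := by
    induction x using induction_on with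
    | zero => simp only [right_smul_zero, add_zero]
    | tmul m n => simp [add_smul, tmul_add]
    | add x y hx hy => simp only [right_smul_add, hx, hy]; abel
  zero_smul x := by
    induction x using induction_on with
    | zero => exact right_smul_zero _
    | tmul m n => simp [tmul_zero]
    | add x y hx hy => rw [right_smul_add, hx, hy, add_zero]

end Right

instance {S S' : Type*} [Ring S] [Module S M] [SMulCommClass S Rᵐᵒᵖ M]
    [Ring S'] [Module S'ᵐᵒᵖ N] [SMulCommClass R S'ᵐᵒᵖ N] :
    SMulCommClass S S'ᵐᵒᵖ (BTensor R M N) where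
  smul_comm s t x := by
    induction x using induction_on with
    | zero => rw [right_smul_zero, smul_zero', right_smul_zero]
    | tmul m n => simp
    | add x y hx hy => rw [right_smul_add, smul_add', hx, hy, smul_add', right_smul_add]

section Assoc

variable {S Q : Type*} [Ring S] [Module Sᵐᵒᵖ N] [SMulCommClass R Sᵐᵒᵖ N]
  [AddCommGroup Q] [Module S Q]

/-- The biadditive map `(m ⊗ n, q) ↦ m ⊗ (n ⊗ q)`. -/
def assocAux : BTensor R M N →+ Q →+ BTensor R M (BTensor S N Q) :=
  lift
    (AddMonoidHom.mk' (fun m => AddMonoidHom.mk' (fun n =>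
        (mk R M (BTensor S N Q) m).comp (mk S N Q n))
        (fun n n' => by ext q; simp [tmul_add]))
      (fun m m' => by ext n q; simp))
    (fun r m n => by ext q; simp [op_smul_tmul])

theorem assocAux_tmul (m : M) (n : N) (q : Q) :
    assocAux (R := R) (S := S) (tmul R m n) q = tmul R m (tmul S n q) := rfl

theorem assocAux_balanced (s : S) (x : BTensor R M N) (q : Q) :
    assocAux (R := R) (S := S) (MulOpposite.op s • x) q =
      assocAux (R := R) (S := S) x (s • q) := by
  induction x using induction_on with
  | zero => simp only [right_smul_zero, map_zero, AddMonoidHom.zero_apply]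
  | tmul m n => rw [right_smul_tmul, assocAux_tmul, assocAux_tmul, op_smul_tmul]
  | add x y hx hy =>
    simp only [right_smul_add, map_add, AddMonoidHom.add_apply, hx, hy]

/-- The associativity map `(M ⊗_R N) ⊗_S Q → M ⊗_R (N ⊗_S Q)`. -/
def assoc : BTensor S (BTensor R M N) Q →+ BTensor R M (BTensor S N Q) :=
  lift assocAux assocAux_balanced

@[simp] theorem assoc_tmul (m : M) (n : N) (q : Q) :
    assoc (R := R) (tmul S (tmul R m n) q) = tmul R m (tmul S n q) := rfl

end Assoc

end BTensor

end Tensor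

/-! ### Bimodules, balanced and faithfully flat modules -/

section Modules

/-- An additive map of `R`-`S`-bimodules that is left `R`-linear and right `S`-linear. -/
structure IsBimoduleHom (R : Type*) (S : Type*) {M N : Type*} [Ring R] [Ring S]
    [AddCommGroup M] [Module R M] [Module Sᵐᵒᵖ M] [AddCommGroup N] [Module R N] [Module Sᵐᵒᵖ N]
    (f : M →+ N) : Prop where
  map_smul : ∀ (r : R) (m : M), f (r • m) = r • f m
  map_op_smul : ∀ (s : S) (m : M), f (MulOpposite.op s • m) = MulOpposite.op s • f m

/-- The `R`-`S`-bimodule `M` is centrally projective with respect to `N`: it is a direct summand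
(i.e. a retract, by bimodule maps) of a finite direct sum of copies of `N`. -/
def IsCentrallyProjective (R : Type*) (S : Type*) (M N : Type*) [Ring R] [Ring S]
    [AddCommGroup M] [Module R M] [Module Sᵐᵒᵖ M] [AddCommGroup N] [Module R N] [Module Sᵐᵒᵖ N] :
    Prop :=
  ∃ (n : ℕ) (i : M →+ (Fin n → N)) (p : (Fin n → N) →+ M),
    IsBimoduleHom R S i ∧ IsBimoduleHom R S p ∧ ∀ m, p (i m) = m

/-- The right `R`-module `M` is balanced: every endomorphism of `M` as a left module over
`End M_R` is the action of an element of `R`. -/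
def IsBalancedModule (R : Type*) (M : Type*) [Ring R] [AddCommGroup M] [Module Rᵐᵒᵖ M] : Prop :=
  ∀ f : M →+ M, (∀ (φ : M →ₗ[Rᵐᵒᵖ] M) (m : M), f (φ m) = φ (f m)) →
    ∃ r : R, ∀ m, f m = MulOpposite.op r • m

/-- The right `R`-module `M` is faithfully flat: `M ⊗_R -` preserves and reflects exactness. -/
def IsFaithfullyFlatModule (R : Type u) (M : Type v) [Ring R] [AddCommGroup M] [Module Rᵐᵒᵖ M] :
    Prop :=
  ∀ (N₁ N₂ N₃ : Type u) [AddCommGroup N₁] [AddCommGroup N₂] [AddCommGroup N₃]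
    [Module R N₁] [Module R N₂] [Module R N₃] (f : N₁ →ₗ[R] N₂) (g : N₂ →ₗ[R] N₃),
    Function.Exact f g ↔
      Function.Exact
        (BTensor.map (R := R) (AddMonoidHom.id M) (fun _ _ => rfl) f.toAddMonoidHom f.map_smul)
        (BTensor.map (R := R) (AddMonoidHom.id M) (fun _ _ => rfl) g.toAddMonoidHom g.map_smul)

end Modules

/-! ### Corings -/

section Corings

/-- An `A`-coring structure on the `A`-`A`-bimodule `C`. -/
structure Coring (A : Type*) (C : Type*) [Ring A] [AddCommGroup C] [Module A C] [Module Aᵐᵒᵖ C]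
    [SMulCommClass A Aᵐᵒᵖ C] where
  comul : C →+ BTensor A C C
  counit : C →+ A
  comul_bimodule : IsBimoduleHom A A comul
  counit_bimodule : IsBimoduleHom A A counit
  /-- `(Δ ⊗ id) ∘ Δ = (id ⊗ Δ) ∘ Δ` -/
  coassoc : ∀ c : C,
    BTensor.assoc (BTensor.map (R := A) comul comul_bimodule.map_op_smul
      (AddMonoidHom.id C) (fun _ _ => rfl) (comul c)) =
    BTensor.map (R := A) (AddMonoidHom.id C) (fun _ _ => rfl)
      comul comul_bimodule.map_smul (comul c)
  /-- `(ε ⊗ id) ∘ Δ = id`, written as `c ↦ 1 ⊗ c` in `A ⊗_A C` -/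
  counit_left : ∀ c : C,
    BTensor.map (R := A) counit counit_bimodule.map_op_smul (AddMonoidHom.id C)
      (fun _ _ => rfl) (comul c) = BTensor.tmul A (1 : A) c
  /-- `(id ⊗ ε) ∘ Δ = id`, written as `c ↦ c ⊗ 1` in `C ⊗_A A` -/
  counit_right : ∀ c : C,
    BTensor.map (R := A) (AddMonoidHom.id C) (fun _ _ => rfl) counit counit_bimodule.map_smul
      (comul c) = BTensor.tmul A c (1 : A)

/-- Homomorphisms of `A`-corings. -/
structure IsCoringHom {A C D : Type*} [Ring A]
    [AddCommGroup C] [Module A C] [Module Aᵐᵒᵖ C] [SMulCommClass A Aᵐᵒᵖ C]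
    [AddCommGroup D] [Module A D] [Module Aᵐᵒᵖ D] [SMulCommClass A Aᵐᵒᵖ D]
    (𝒞 : Coring A C) (𝒟 : Coring A D) (f : C →+ D) : Prop where
  bimodule : IsBimoduleHom A A f
  comul_comp : ∀ c, 𝒟.comul (f c) =
    BTensor.map (R := A) f bimodule.map_op_smul f bimodule.map_smul (𝒞.comul c)
  counit_comp : ∀ c, 𝒟.counit (f c) = 𝒞.counit c

/-- Grouplike elements of a coring. -/
structure Coring.IsGrouplike {A C : Type*} [Ring A] [AddCommGroup C] [Module A C]
    [Module Aᵐᵒᵖ C] [SMulCommClass A Aᵐᵒᵖ C] (𝒞 : Coring A C) (x : C) : Prop where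
  comul_eq : 𝒞.comul x = BTensor.tmul A x x
  counit_eq : 𝒞.counit x = 1

/-- The coinvariants `A^{co C} = {a ∈ A | a x = x a}` of an `A`-coring `C` with respect to its
grouplike element `x`. -/
def coinvariants (A : Type*) {C : Type*} [Ring A] [AddCommGroup C] [Module A C] [Module Aᵐᵒᵖ C]
    [SMulCommClass A Aᵐᵒᵖ C] (x : C) : Subring A where
  carrier := {a | a • x = MulOpposite.op a • x}
  zero_mem' := by simp
  one_mem' := by simp
  add_mem' {a b} ha hb := by
    simp only [Set.mem_ofPred_eq] at *
    rw [add_smul, MulOpposite.op_add, add_smul, ha, hb]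
  neg_mem' {a} ha := by
    simp only [Set.mem_ofPred_eq] at *
    rw [neg_smul, MulOpposite.op_neg, neg_smul, ha]
  mul_mem' {a b} ha hb := by
    simp only [Set.mem_ofPred_eq] at *
    rw [mul_smul, hb, smul_comm, ha, MulOpposite.op_mul, mul_smul]

end Corings

/-! ### Ring extensions

A ring extension is a ring `A` with a subring `B`. -/

section Extensions

variable {A : Type u} [Ring A]

/-- `A` as a right module over a subring: `a · b = ab`. -/
instance subringRightModule (B : Subring A) : Module (↥B)ᵐᵒᵖ A :=
  Module.compHom A (RingHom.op B.subtype)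

@[simp] theorem subring_op_smul (B : Subring A) (b : B) (a : A) :
    MulOpposite.op b • a = a * (b : A) := rfl

instance (B : Subring A) : SMulCommClass A (↥B)ᵐᵒᵖ A where
  smul_comm a b x := (mul_assoc a x (b.unop : A)).symm

/-- The tensor-square `A ⊗_B A`. It is an `A`-`A`-bimodule by the outer actions. -/
abbrev TensorSquare (B : Subring A) : Type u := BTensor B A A

/-- `A ‖ B` has (left and right) depth two: `A ⊗_B A` is centrally projective with respect to `A`,
both as `B`-`A`-bimodules (left) and as `A`-`B`-bimodules (right). -/
structure IsDepthTwo (B : Subring A) : Prop where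
  left : IsCentrallyProjective B A (TensorSquare B) A
  right : IsCentrallyProjective A B (TensorSquare B) A

/-- `a ⊗ a' ↦ (a ⊗ 1) ⊗_A (1 ⊗ a')` -/
def sweedlerComul (B : Subring A) :
    TensorSquare B →+ BTensor A (TensorSquare B) (TensorSquare B) :=
  BTensor.lift
    (AddMonoidHom.mk' (fun a => AddMonoidHom.mk'
        (fun a' => BTensor.tmul A (BTensor.tmul B a (1 : A)) (BTensor.tmul B (1 : A) a'))
        (fun x y => by simp [BTensor.tmul_add]))
      (fun x y => by ext z; simp [BTensor.add_tmul]))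
    (fun b m n => by
      have h1 : BTensor.tmul B (m * (b : A)) (1 : A) =
          MulOpposite.op (b : A) • BTensor.tmul B m (1 : A) := by
        rw [← subring_op_smul, BTensor.op_smul_tmul]; simp [Subring.smul_def]
      have h2 : BTensor.tmul B (1 : A) ((b : A) * n) =
          (b : A) • BTensor.tmul B (1 : A) n := by
        have := BTensor.op_smul_tmul b (1 : A) n
        simpa [Subring.smul_def] using this.symm
      simp only [AddMonoidHom.mk'_apply, subring_op_smul, Subring.smul_def, smul_eq_mul]
      rw [h1, h2, BTensor.op_smul_tmul])

@[simp] theorem sweedlerComul_tmul (B : Subring A) (a a' : A) :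
    sweedlerComul B (BTensor.tmul B a a') =
      BTensor.tmul A (BTensor.tmul B a (1 : A)) (BTensor.tmul B (1 : A) a') := rfl

theorem sweedlerComul_bimodule (B : Subring A) : IsBimoduleHom A A (sweedlerComul B) := by
  constructor
  · intro a x
    induction x using BTensor.induction_on with
    | zero => simp
    | tmul m n => simp
    | add x y hx hy => simp [hx, hy]
  · intro a x
    induction x using BTensor.induction_on with
    | zero => simp
    | tmul m n => simp
    | add x y hx hy => simp [hx, hy]

/-- `a ⊗ a' ↦ aa'` -/
def sweedlerCounit (B : Subring A) : TensorSquare B →+ A :=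
  BTensor.lift AddMonoidHom.mul (fun b m n => by simp [Subring.smul_def, mul_assoc])

@[simp] theorem sweedlerCounit_tmul (B : Subring A) (a a' : A) :
    sweedlerCounit B (BTensor.tmul B a a') = a * a' := rfl

theorem sweedlerCounit_bimodule (B : Subring A) : IsBimoduleHom A A (sweedlerCounit B) := by
  constructor
  · intro a x
    induction x using BTensor.induction_on with
    | zero => simp
    | tmul m n => simp [mul_assoc]
    | add x y hx hy => simp [hx, hy, mul_add]
  · intro a x
    induction x using BTensor.induction_on with
    | zero => simp
    | tmul m n => simp [mul_assoc]
    | add x y hx hy => simp [hx, hy]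

/-- The Sweedler coring `A ⊗_B A`, with `Δ(a ⊗ a') = (a ⊗ 1) ⊗_A (1 ⊗ a')`, `ε(a ⊗ a') = aa'`. -/
def sweedlerCoring (B : Subring A) : Coring A (TensorSquare B) where
  comul := sweedlerComul B
  counit := sweedlerCounit B
  comul_bimodule := sweedlerComul_bimodule B
  counit_bimodule := sweedlerCounit_bimodule B
  coassoc x := by
    induction x using BTensor.induction_on with
    | zero => simp
    | tmul m n => simp
    | add x y hx hy => simp only [map_add, hx, hy]
  counit_left x := by
    induction x using BTensor.induction_on with
    | zero => simp [BTensor.tmul_zero]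
    | tmul m n =>
      have h2 := BTensor.op_smul_tmul m (1 : A) (BTensor.tmul B (1 : A) n)
      rw [sweedlerComul_tmul, BTensor.map_tmul, sweedlerCounit_tmul, mul_one]
      rw [BTensor.smul_tmul, smul_eq_mul, mul_one, op_smul_eq_mul, one_mul] at h2
      exact h2
    | add x y hx hy => simp only [map_add, hx, hy, BTensor.tmul_add]
  counit_right x := by
    induction x using BTensor.induction_on with
    | zero => simp [BTensor.zero_tmul]
    | tmul m n =>
      have h2 := BTensor.op_smul_tmul n (BTensor.tmul B m (1 : A)) (1 : A)
      rw [sweedlerComul_tmul, BTensor.map_tmul, sweedlerCounit_tmul, one_mul]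
      rw [BTensor.right_smul_tmul, op_smul_eq_mul, one_mul, smul_eq_mul, mul_one] at h2
      exact h2.symm
    | add x y hx hy => simp only [map_add, hx, hy, BTensor.add_tmul]

/-- The canonical map `can : A ⊗_B A → C`, `a ⊗ a' ↦ a x a'`, for a subring `B` of `A^{co C}`. -/
def can {C : Type*} [AddCommGroup C] [Module A C] [Module Aᵐᵒᵖ C] [SMulCommClass A Aᵐᵒᵖ C]
    (x : C) (B : Subring A) (hB : B ≤ coinvariants A x) : TensorSquare B →+ C :=
  BTensor.lift
    (AddMonoidHom.mk' (fun a => AddMonoidHom.mk' (fun a' => a • (MulOpposite.op a' • x))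
        (fun y z => by rw [MulOpposite.op_add, add_smul, smul_add]))
      (fun y z => by ext t; simp [add_smul]))
    (fun b m n => by
      have hb : (b : A) • x = MulOpposite.op (b : A) • x := hB b.2
      simp only [AddMonoidHom.mk'_apply, subring_op_smul, Subring.smul_def, smul_eq_mul,
        MulOpposite.op_mul, mul_smul]
      rw [← hb, smul_comm (b : A) (MulOpposite.op n) x])

/-- `(C, x)` is a Galois `A`-coring: `x` is grouplike, and the canonical map from the Sweedler
coring of `A` over the coinvariants to `C` is an isomorphism of corings. -/
structure Coring.IsGalois {C : Type*} [AddCommGroup C] [Module A C] [Module Aᵐᵒᵖ C]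
    [SMulCommClass A Aᵐᵒᵖ C] (𝒞 : Coring A C) (x : C) : Prop where
  grouplike : 𝒞.IsGrouplike x
  can_hom : IsCoringHom (sweedlerCoring (coinvariants A x)) 𝒞 (can x _ le_rfl)
  can_bijective : Function.Bijective (can x (coinvariants A x) le_rfl)

/-- The centralizer `R = A^B` of `B` in `A`. -/
abbrev centralizerRing (B : Subring A) : Subring A := Subring.centralizer (B : Set A)

/-- `S = End _B A_B`, the bimodule endomorphisms of `A`. -/
def bimoduleEnd (B : Subring A) : AddSubgroup (A →+ A) where
  carrier := {f | IsBimoduleHom B B f}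
  zero_mem' := ⟨fun b _ => (smul_zero b).symm, fun b _ => (smul_zero (MulOpposite.op b)).symm⟩
  add_mem' {f g} hf hg := ⟨fun b a => by
      rw [AddMonoidHom.add_apply, hf.map_smul, hg.map_smul, AddMonoidHom.add_apply, smul_add],
    fun b a => by
      rw [AddMonoidHom.add_apply, hf.map_op_smul, hg.map_op_smul, AddMonoidHom.add_apply,
        smul_add]⟩
  neg_mem' {f} hf := ⟨fun b a => by
      rw [AddMonoidHom.neg_apply, hf.map_smul, AddMonoidHom.neg_apply, smul_neg],
    fun b a => by
      rw [AddMonoidHom.neg_apply, hf.map_op_smul, AddMonoidHom.neg_apply, smul_neg]⟩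

/-- `T = (A ⊗_B A)^B`, the `B`-central elements of the tensor-square. -/
def centralTensors (B : Subring A) : AddSubgroup (TensorSquare B) where
  carrier := {t | ∀ b ∈ B, b • t = MulOpposite.op b • t}
  zero_mem' := by simp
  add_mem' {s t} hs ht b hb := by rw [smul_add, hs b hb, ht b hb, smul_add]
  neg_mem' {t} ht b hb := by rw [smul_neg, ht b hb, smul_neg]

variable {B : Subring A}

namespace centralTensors

@[ext] theorem ext {s t : centralTensors B} (h : (s : TensorSquare B) = t) : s = t :=
  Subtype.ext h

/-- For `t ∈ T`, the map `A ⊗_B A → A ⊗_B A`, `a ⊗ a' ↦ a t a'`. -/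
def insert (t : centralTensors B) : TensorSquare B →+ TensorSquare B :=
  can (t : TensorSquare B) B (fun b hb => t.2 b hb)

@[simp] theorem insert_tmul (t : centralTensors B) (a a' : A) :
    insert t (BTensor.tmul B a a') = a • (MulOpposite.op a' • (t : TensorSquare B)) := rfl

theorem insert_smul (t : centralTensors B) (a : A) (x : TensorSquare B) :
    insert t (a • x) = a • insert t x := by
  induction x using BTensor.induction_on with
  | zero => simp
  | tmul m n => simp [mul_smul]
  | add x y hx hy => simp [hx, hy]

theorem insert_op_smul (t : centralTensors B) (a : A) (x : TensorSquare B) :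
    insert t (MulOpposite.op a • x) = MulOpposite.op a • insert t x := by
  induction x using BTensor.induction_on with
  | zero => simp
  | tmul m n => simp [mul_smul, smul_comm]
  | add x y hx hy => simp [hx, hy]

/-- The product `t t' = t'¹t¹ ⊗ t²t'²`. -/
instance : Mul (centralTensors B) where
  mul t t' := ⟨insert t (t' : TensorSquare B), fun b hb => by
    rw [← insert_smul, t'.2 b hb, insert_op_smul]⟩

/-- The unit `1_T = 1 ⊗ 1`. -/
instance : One (centralTensors B) where
  one := ⟨BTensor.tmul B (1 : A) (1 : A), fun b hb => by
    have := BTensor.op_smul_tmul (⟨b, hb⟩ : B) (1 : A) (1 : A)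
    simpa [Subring.smul_def] using this⟩

theorem coe_mul (t t' : centralTensors B) :
    ((t * t' : centralTensors B) : TensorSquare B) = insert t (t' : TensorSquare B) := rfl

theorem coe_one : ((1 : centralTensors B) : TensorSquare B) = BTensor.tmul B (1 : A) (1 : A) :=
  rfl

theorem insert_mul (s t : centralTensors B) (x : TensorSquare B) :
    insert (s * t) x = insert s (insert t x) := by
  induction x using BTensor.induction_on with
  | zero => simp
  | tmul m n => simp [coe_mul, insert_smul, insert_op_smul]
  | add x y hx hy => simp [hx, hy]

theorem insert_one (x : TensorSquare B) : insert (1 : centralTensors B) x = x := by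
  induction x using BTensor.induction_on with
  | zero => simp
  | tmul m n => simp [coe_one]
  | add x y hx hy => simp [hx, hy]

theorem insert_add (s t : centralTensors B) (x : TensorSquare B) :
    insert (s + t) x = insert s x + insert t x := by
  induction x using BTensor.induction_on with
  | zero => simp
  | tmul m n => simp
  | add x y hx hy => simp only [map_add, hx, hy]; abel

instance : Ring (centralTensors B) where
  __ := (inferInstance : AddCommGroup (centralTensors B))
  mul := (· * ·)
  one := 1
  mul_assoc s t t' := by ext; exact insert_mul s t _
  one_mul t := by ext; exact insert_one _
  mul_one t := by ext; simp [coe_mul, coe_one]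
  left_distrib s t t' := by ext; simp [coe_mul]
  right_distrib s t t' := by ext; simp [coe_mul, insert_add]
  zero_mul t := by
    have h : (0 : centralTensors B) * t + 0 * t = 0 * t := by
      ext; simp only [AddSubgroup.coe_add, coe_mul]; rw [← insert_add, add_zero]
    exact left_eq_add.1 h.symm
  mul_zero t := by ext; simp [coe_mul]

/-- The left action `r t = rt¹ ⊗ t²` of `R` on `T`, i.e. `r t = t (r ⊗ 1)`. -/
instance : Module (centralizerRing B) (centralTensors B) where
  smul r t := ⟨(r : A) • (t : TensorSquare B), fun b hb => by
    rw [← mul_smul, Subring.mem_centralizer_iff.1 r.2 b hb, mul_smul, t.2 b hb, smul_comm]⟩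
  one_smul t := by ext; exact one_smul A _
  mul_smul r s t := by ext; exact mul_smul (r : A) (s : A) _
  smul_zero r := by ext; exact smul_zero (r : A)
  smul_add r s t := by ext; exact smul_add (r : A) _ _
  add_smul r s t := by ext; exact add_smul (r : A) (s : A) _
  zero_smul t := by ext; exact zero_smul A _

/-- The right action `t r = t¹ ⊗ t²r` of `R` on `T`, i.e. `t r = t (1 ⊗ r)`. -/
instance : Module (↥(centralizerRing B))ᵐᵒᵖ (centralTensors B) where
  smul r t := ⟨MulOpposite.op (r.unop : A) • (t : TensorSquare B), fun b hb => by
    rw [smul_comm, t.2 b hb, ← mul_smul, ← mul_smul, ← MulOpposite.op_mul, ← MulOpposite.op_mul,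
      Subring.mem_centralizer_iff.1 r.unop.2 b hb]⟩
  one_smul t := by ext; exact one_smul Aᵐᵒᵖ _
  mul_smul r s t := by
    ext; exact mul_smul (MulOpposite.op (r.unop : A)) (MulOpposite.op (s.unop : A)) _
  smul_zero r := by ext; exact smul_zero (MulOpposite.op (r.unop : A))
  smul_add r s t := by ext; exact smul_add (MulOpposite.op (r.unop : A)) _ _
  add_smul r s t := by
    ext; exact add_smul (MulOpposite.op (r.unop : A)) (MulOpposite.op (s.unop : A)) _
  zero_smul t := by ext; exact zero_smul Aᵐᵒᵖ _

theorem coe_smul (r : centralizerRing B) (t : centralTensors B) :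
    ((r • t : centralTensors B) : TensorSquare B) = (r : A) • (t : TensorSquare B) := rfl

theorem coe_op_smul (r : centralizerRing B) (t : centralTensors B) :
    ((MulOpposite.op r • t : centralTensors B) : TensorSquare B) =
      MulOpposite.op (r : A) • (t : TensorSquare B) := rfl

instance : SMulCommClass (centralizerRing B) (↥(centralizerRing B))ᵐᵒᵖ (centralTensors B) where
  smul_comm r s t := by
    ext; exact smul_comm (r : A) (MulOpposite.op (s.unop : A)) (t : TensorSquare B)

/-- The counit `ε_T(t) = t¹t²` of `T`, with values in `R`. -/
def counit (t : centralTensors B) : centralizerRing B :=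
  ⟨sweedlerCounit B t, Subring.mem_centralizer_iff.2 fun b hb => by
    have h1 := (sweedlerCounit_bimodule B).map_smul b (t : TensorSquare B)
    have h2 := (sweedlerCounit_bimodule B).map_op_smul b (t : TensorSquare B)
    rw [t.2 b hb, h2] at h1
    exact h1.symm⟩

/-- For `γ ∈ S`, the map `A ⊗_B A → A ⊗_B A`, `a ⊗ a' ↦ a ⊗ γ(a')`. -/
def idTensor (γ : bimoduleEnd B) : TensorSquare B →+ TensorSquare B :=
  BTensor.map (R := B) (AddMonoidHom.id A) (fun _ _ => rfl) (γ : A →+ A) γ.2.map_smul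

theorem idTensor_tmul (γ : bimoduleEnd B) (a a' : A) :
    idTensor γ (BTensor.tmul B a a') = BTensor.tmul B a ((γ : A →+ A) a') := rfl

/-- For `γ ∈ S`, the map `T → T`, `t ↦ t¹ ⊗ γ(t²)`. -/
def applyRight (γ : bimoduleEnd B) (t : centralTensors B) : centralTensors B :=
  ⟨idTensor γ (t : TensorSquare B), fun b hb => by
    have h1 : ∀ x : TensorSquare B, idTensor γ (b • x) = b • idTensor γ x := by
      intro x
      induction x using BTensor.induction_on with
      | zero => simp
      | tmul m n => rfl
      | add x y hx hy => simp only [smul_add, map_add, hx, hy]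
    have h2 : ∀ x : TensorSquare B,
        idTensor γ (MulOpposite.op b • x) = MulOpposite.op b • idTensor γ x := by
      intro x
      induction x using BTensor.induction_on with
      | zero => simp
      | tmul m n => exact congrArg (BTensor.tmul B m) (γ.2.map_op_smul ⟨b, hb⟩ n)
      | add x y hx hy => simp only [smul_add, map_add, hx, hy]
    rw [← h1, t.2 b hb, h2]⟩

end centralTensors

variable (B) in
/-- A right D2 quasibase: `γ_j ∈ S`, `u_j ∈ T` with `a ⊗ a' = ∑ a γ_j(a') u_j`. -/
def IsRightD2Quasibase {n : ℕ} (γ : Fin n → bimoduleEnd B) (u : Fin n → centralTensors B) :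
    Prop :=
  ∀ a a' : A, BTensor.tmul B a a' =
    ∑ j, (a * (γ j : A →+ A) a') • (u j : TensorSquare B)

/-- The comultiplication `Δ_T(t) = ∑ (t¹ ⊗ γ_j(t²)) ⊗_R u_j` of `T`. -/
def centralTensors.comul {n : ℕ} (γ : Fin n → bimoduleEnd B) (u : Fin n → centralTensors B)
    (t : centralTensors B) :
    BTensor (centralizerRing B) (centralTensors B) (centralTensors B) :=
  ∑ j, BTensor.tmul (centralizerRing B) (centralTensors.applyRight (γ j) t) (u j)

variable (B) in
/-- The underlying left `A`-module `A ⊗_R T`, with `a (a' ⊗ t) = aa' ⊗ t`. -/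
abbrev GaloisModule : Type u := BTensor (centralizerRing B) A (centralTensors B)

/-- The coaction `ρ(a) = ∑ γ_j(a) ⊗ u_j`. -/
def coaction {n : ℕ} (γ : Fin n → bimoduleEnd B) (u : Fin n → centralTensors B) (a : A) :
    GaloisModule B :=
  ∑ j, BTensor.tmul (centralizerRing B) ((γ j : A →+ A) a) (u j)

end Extensions

/-! Everything comes from one identification: `a ⊗ t ↦ at¹ ⊗ t²` is a left `A`-linear bijection β
from `A ⊗_R T` to `A ⊗_B A`. A right D2 quasibase supplies the inverse `y ↦ ∑ y¹γ_j(y²) ⊗ u_j`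
(`IsRightD2Quasibase.galoisToSquare_bijective`). The right action is pulled back along β and the
Sweedler coring structure is carried over by `Coring.ofEquiv`, so no coring axiom is checked by
hand.

This structure does not depend on a quasibase. The stated formulas hold for each one because β sends
`ρ(a)` to `1 ⊗ a` (`galoisToSquare_coaction`) and `Δ_T(t)` maps to the Sweedler comultiplication of
`t` (`centralTensorsToSquare_comul`).

Since `β(1 ⊗ 1_T) = 1 ⊗ 1`, the element `x` is grouplike, `can` over `B` is the inverse of β, and
`a` is coinvariant exactly when `a ⊗ 1 = 1 ⊗ a` in `A ⊗_B A`. Bijectivity of `can` passes from `B`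
to the larger ring of coinvariants by `can_bijective_of_le`. Finally, `a ⊗ 1 = 1 ⊗ a` forces `a ∈ B`
when `A_B` is balanced or faithfully flat. -/

namespace IsBimoduleHom

variable {A : Type*} [Ring A] {X Y Z : Type*}
  [AddCommGroup X] [Module A X] [Module Aᵐᵒᵖ X] [AddCommGroup Y] [Module A Y] [Module Aᵐᵒᵖ Y]
  [AddCommGroup Z] [Module A Z] [Module Aᵐᵒᵖ Z]

theorem symm {e : X ≃+ Y} (h : IsBimoduleHom A A (e : X →+ Y)) :
    IsBimoduleHom A A (e.symm : Y →+ X) where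
  map_smul a c := e.injective <| by
    simpa using (h.map_smul a (e.symm c)).symm
  map_op_smul a c := e.injective <| by
    simpa using (h.map_op_smul a (e.symm c)).symm

theorem comp {g : Y →+ Z} {f : X →+ Y}
    (hg : IsBimoduleHom A A g) (hf : IsBimoduleHom A A f) : IsBimoduleHom A A (g.comp f) where
  map_smul a x := by simp [hf.map_smul, hg.map_smul]
  map_op_smul a x := by simp [hf.map_op_smul, hg.map_op_smul]

end IsBimoduleHom

/-! ### Transport of coring structures along bimodule isomorphisms. -/

namespace Coring

variable {A : Type*} {C D : Type*} [Ring A]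
  [AddCommGroup C] [Module A C] [Module Aᵐᵒᵖ C] [SMulCommClass A Aᵐᵒᵖ C]
  [AddCommGroup D] [Module A D] [Module Aᵐᵒᵖ D] [SMulCommClass A Aᵐᵒᵖ D]

/-- The tensor square `f ⊗_A f` of a bimodule homomorphism. -/
def mapSquare {f : D →+ C} (h : IsBimoduleHom A A f) : BTensor A D D →+ BTensor A C C :=
  BTensor.map (R := A) f h.map_op_smul f h.map_smul

@[simp] theorem mapSquare_tmul {f : D →+ C} (h : IsBimoduleHom A A f) (x y : D) :
    mapSquare h (BTensor.tmul A x y) = BTensor.tmul A (f x) (f y) := rfl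

theorem mapSquare_bimodule {f : D →+ C} (h : IsBimoduleHom A A f) :
    IsBimoduleHom A A (mapSquare h) where
  map_smul a x := by
    induction x using BTensor.induction_on with
    | zero => simp
    | tmul m n => simp [h.map_smul]
    | add x y hx hy => simp only [smul_add, map_add, hx, hy]
  map_op_smul a x := by
    induction x using BTensor.induction_on with
    | zero => simp
    | tmul m n => simp [h.map_op_smul]
    | add x y hx hy => simp only [smul_add, map_add, hx, hy]

/-- The coring structure transported along an isomorphism of bimodules. -/
def ofEquiv (𝒟 : Coring A D) (e : D ≃+ C) (h : IsBimoduleHom A A (e : D →+ C)) :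
    Coring A C where
  comul := (mapSquare h).comp (𝒟.comul.comp (e.symm : C →+ D))
  counit := 𝒟.counit.comp (e.symm : C →+ D)
  comul_bimodule := (mapSquare_bimodule h).comp (𝒟.comul_bimodule.comp h.symm)
  counit_bimodule := 𝒟.counit_bimodule.comp h.symm
  coassoc c := by
    obtain ⟨d, rfl⟩ := e.surjective c
    -- `F` is `e ⊗ (e ⊗ e)`. It carries each side of coassociativity for `𝒟` to the corresponding
    -- side for the new structure.
    let F : BTensor A D (BTensor A D D) →+ BTensor A C (BTensor A C C) :=
      BTensor.map (R := A) (e : D →+ C) h.map_op_smul (mapSquare h) (mapSquare_bimodule h).map_smul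
    have key := congrArg F (𝒟.coassoc d)
    have assoc_eq : ∀ (z : BTensor A D D) (n : D),
        BTensor.assoc (BTensor.tmul A (mapSquare h z) (e n)) =
          F (BTensor.assoc (BTensor.tmul A z n)) := by
      intro z n
      induction z using BTensor.induction_on with
      | zero => simp [BTensor.zero_tmul]
      | tmul m m' => simp [F]
      | add x y hx hy => simp only [map_add, BTensor.add_tmul, hx, hy]
    have h1 : ∀ y : BTensor A D D, BTensor.assoc (BTensor.map (R := A)
          ((mapSquare h).comp (𝒟.comul.comp (e.symm : C →+ D)))
          ((mapSquare_bimodule h).comp (𝒟.comul_bimodule.comp h.symm)).map_op_smul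
          (AddMonoidHom.id C) (fun _ _ => rfl) (mapSquare h y)) =
        F (BTensor.assoc (BTensor.map (R := A) 𝒟.comul 𝒟.comul_bimodule.map_op_smul
          (AddMonoidHom.id D) (fun _ _ => rfl) y)) := fun y => by
      induction y using BTensor.induction_on with
      | zero => simp
      | tmul m n => simpa using assoc_eq (𝒟.comul m) n
      | add x y hx hy => simp only [map_add, hx, hy]
    have h2 : ∀ y : BTensor A D D, BTensor.map (R := A) (AddMonoidHom.id C) (fun _ _ => rfl)
          ((mapSquare h).comp (𝒟.comul.comp (e.symm : C →+ D)))
          ((mapSquare_bimodule h).comp (𝒟.comul_bimodule.comp h.symm)).map_smul (mapSquare h y) =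
        F (BTensor.map (R := A) (AddMonoidHom.id D) (fun _ _ => rfl)
          𝒟.comul 𝒟.comul_bimodule.map_smul y) := fun y => by
      induction y using BTensor.induction_on with
      | zero => simp
      | tmul m n => simp [F]
      | add x y hx hy => simp only [map_add, hx, hy]
    have h1' := h1 (𝒟.comul d)
    have h2' := h2 (𝒟.comul d)
    simp only [AddMonoidHom.comp_apply, AddMonoidHom.coe_coe, AddEquiv.symm_apply_apply] at *
    exact h1'.trans (key.trans h2'.symm)
  counit_left c := by
    obtain ⟨d, rfl⟩ := e.surjective c
    have h1 : ∀ y : BTensor A D D, BTensor.map (R := A) (𝒟.counit.comp (e.symm : C →+ D))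
          (𝒟.counit_bimodule.comp h.symm).map_op_smul
          (AddMonoidHom.id C) (fun _ _ => rfl) (mapSquare h y) =
        BTensor.map (R := A) (AddMonoidHom.id A) (fun _ _ => rfl) (e : D →+ C) h.map_smul
          (BTensor.map (R := A) 𝒟.counit 𝒟.counit_bimodule.map_op_smul
          (AddMonoidHom.id D) (fun _ _ => rfl) y) := fun y => by
      induction y using BTensor.induction_on with
      | zero => simp
      | tmul m n => simp
      | add x y hx hy => simp only [map_add, hx, hy]
    have h1' := h1 (𝒟.comul d)
    rw [𝒟.counit_left d] at h1'
    simpa using h1'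
  counit_right c := by
    obtain ⟨d, rfl⟩ := e.surjective c
    have h1 : ∀ y : BTensor A D D, BTensor.map (R := A) (AddMonoidHom.id C) (fun _ _ => rfl)
          (𝒟.counit.comp (e.symm : C →+ D)) (𝒟.counit_bimodule.comp h.symm).map_smul
          (mapSquare h y) =
        BTensor.map (R := A) (e : D →+ C) h.map_op_smul (AddMonoidHom.id A) (fun _ _ => rfl)
          (BTensor.map (R := A) (AddMonoidHom.id D) (fun _ _ => rfl)
            𝒟.counit 𝒟.counit_bimodule.map_smul y) := fun y => by
      induction y using BTensor.induction_on with
      | zero => simp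
      | tmul m n => simp
      | add x y hx hy => simp only [map_add, hx, hy]
    have h1' := h1 (𝒟.comul d)
    rw [𝒟.counit_right d] at h1'
    simpa using h1'

theorem ofEquiv_comul (𝒟 : Coring A D) (e : D ≃+ C) (h : IsBimoduleHom A A (e : D →+ C)) (d : D) :
    (𝒟.ofEquiv e h).comul (e d) = mapSquare h (𝒟.comul d) := by
  simp [ofEquiv]

theorem ofEquiv_counit (𝒟 : Coring A D) (e : D ≃+ C) (h : IsBimoduleHom A A (e : D →+ C)) (d : D) :
    (𝒟.ofEquiv e h).counit (e d) = 𝒟.counit d := by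
  simp [ofEquiv]

end Coring

/-! ### The canonical map and change of base subring. -/

section CanonicalMap

variable {A : Type u} [Ring A] {C : Type*} [AddCommGroup C] [Module A C] [Module Aᵐᵒᵖ C]
  [SMulCommClass A Aᵐᵒᵖ C]

@[simp] theorem can_tmul (x : C) (B : Subring A) (hB : B ≤ coinvariants A x) (a a' : A) :
    can x B hB (BTensor.tmul B a a') = a • (MulOpposite.op a' • x) := rfl

theorem can_bimodule (x : C) (B : Subring A) (hB : B ≤ coinvariants A x) :
    IsBimoduleHom A A (can x B hB) where
  map_smul a y := by
    induction y using BTensor.induction_on with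
    | zero => simp
    | tmul m n => simp [mul_smul]
    | add x y hx hy => simp only [smul_add, map_add, hx, hy]
  map_op_smul a y := by
    induction y using BTensor.induction_on with
    | zero => simp
    | tmul m n => simp [mul_smul, smul_comm]
    | add x y hx hy => simp only [smul_add, map_add, hx, hy]

/-- Bilinearity gives `Δ(axa') = ax ⊗ xa'` and `ε(axa') = aa'`, which are the images of the Sweedler
formulas. Bijectivity plays no role here. -/
theorem Coring.IsGrouplike.isCoringHom_can {𝒞 : Coring A C} {x : C} (hx : 𝒞.IsGrouplike x)
    (B : Subring A) (hB : B ≤ coinvariants A x) :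
    IsCoringHom (sweedlerCoring B) 𝒞 (can x B hB) where
  bimodule := can_bimodule x B hB
  comul_comp y := by
    induction y using BTensor.induction_on with
    | zero => simp
    | tmul m n =>
      rw [can_tmul, 𝒞.comul_bimodule.map_smul, 𝒞.comul_bimodule.map_op_smul, hx.comul_eq]
      change _ = BTensor.map (R := A) _ _ _ _ (sweedlerComul B (BTensor.tmul B m n))
      simp
    | add x y hx hy => simp only [map_add, hx, hy]
  counit_comp y := by
    induction y using BTensor.induction_on with
    | zero => simp
    | tmul m n =>
      rw [can_tmul, 𝒞.counit_bimodule.map_smul, 𝒞.counit_bimodule.map_op_smul, hx.counit_eq]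
      change _ = sweedlerCounit B (BTensor.tmul B m n)
      simp
    | add x y hx hy => simp only [map_add, hx, hy]

/-- If the canonical map over a subring of the coinvariants is bijective, then so is the
canonical map over every larger subring of the coinvariants. -/
theorem can_bijective_of_le {x : C} {B D : Subring A} (hBD : B ≤ D) (hD : D ≤ coinvariants A x)
    (h : Function.Bijective (can x B (hBD.trans hD))) : Function.Bijective (can x D hD) := by
  -- The projection `A ⊗_B A → A ⊗_D A` is onto and `can` over `B` factors through it, so
  -- injectivity and surjectivity both descend.
  let π : TensorSquare B →+ TensorSquare D := BTensor.lift (BTensor.mk D A A)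
    (fun b m n => BTensor.op_smul_tmul (⟨b, hBD b.2⟩ : D) m n)
  have hπ : ∀ y, can x D hD (π y) = can x B (hBD.trans hD) y := fun y => by
    induction y using BTensor.induction_on with
    | zero => simp
    | tmul m n => rfl
    | add x y hx hy => simp only [map_add, hx, hy]
  have hsurj : Function.Surjective π := fun y => by
    induction y using BTensor.induction_on with
    | zero => exact ⟨0, map_zero π⟩
    | tmul m n => exact ⟨BTensor.tmul B m n, rfl⟩
    | add x y hx hy =>
      obtain ⟨x, rfl⟩ := hx
      obtain ⟨y, rfl⟩ := hy
      exact ⟨x + y, map_add π x y⟩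
  refine ⟨fun y z hyz => ?_, fun c => ?_⟩
  · obtain ⟨y, rfl⟩ := hsurj y
    obtain ⟨z, rfl⟩ := hsurj z
    rw [hπ, hπ] at hyz
    rw [h.1 hyz]
  · obtain ⟨y, rfl⟩ := h.2 c
    exact ⟨π y, hπ y⟩

end CanonicalMap

/-! ### Descent: when `a ⊗ 1 = 1 ⊗ a` implies `a ∈ B`. -/

section Extensions

variable {A : Type u} [Ring A] {B : Subring A}

theorem mem_coinvariants_iff {C : Type*} [AddCommGroup C] [Module A C] [Module Aᵐᵒᵖ C]
    [SMulCommClass A Aᵐᵒᵖ C] {x : C} {a : A} :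
    a ∈ coinvariants A x ↔ a • x = MulOpposite.op a • x := Iff.rfl

theorem tmul_one_eq_one_tmul_of_mem {b : A} (hb : b ∈ B) :
    BTensor.tmul B b (1 : A) = BTensor.tmul B 1 b := by
  simpa [Subring.smul_def] using BTensor.op_smul_tmul (⟨b, hb⟩ : B) (1 : A) (1 : A)

/-- Right multiplication by `a` commutes with every `φ ∈ End(A_B)`: apply `m' ⊗ n ↦ φ(m')n` to `ma ⊗
1 = m ⊗ a`. Balancedness makes it right multiplication by some `b ∈ B`, and evaluation at 1 gives `a
= b`. -/
theorem mem_of_tmul_eq_of_isBalancedModule (hB : IsBalancedModule B A) {a : A}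
    (ha : BTensor.tmul B a (1 : A) = BTensor.tmul B 1 a) : a ∈ B := by
  obtain ⟨b, hb⟩ := hB (AddMonoidHom.mulRight a) fun φ m => by
    let F : TensorSquare B →+ A := BTensor.lift (AddMonoidHom.mul.comp φ.toAddMonoidHom)
      (fun b m n => by
        have : φ (m * (b : A)) = φ m * b := φ.map_smul (MulOpposite.op b) m
        simp [this, Subring.smul_def, mul_assoc])
    have h : φ (m * a) * 1 = φ (m * 1) * a := congrArg (fun y => F (m • y)) ha
    simpa using h.symm
  have := hb 1
  simp at this
  exact this ▸ b.2

theorem BTensor.eq_zero_of_subsingleton {R M N : Type*} [Ring R] [AddCommGroup M]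
    [Module Rᵐᵒᵖ M] [AddCommGroup N] [Module R N] [Subsingleton N] (y : BTensor R M N) :
    y = 0 := by
  induction y using BTensor.induction_on with
  | zero => rfl
  | tmul m n => rw [Subsingleton.elim n 0, BTensor.tmul_zero]
  | add x y hx hy => rw [hx, hy, add_zero]

/-- Let `q : A → A/B` be the quotient map of left `B`-modules and `N` the cyclic submodule generated
by `q(a)`. The hypothesis kills the generator of `A ⊗_B N`, and faithfulness then gives `N = 0`. -/
theorem mem_of_tmul_eq_of_isFaithfullyFlatModule (hB : IsFaithfullyFlatModule B A) {a : A}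
    (ha : BTensor.tmul B a (1 : A) = BTensor.tmul B 1 a) : a ∈ B := by
  let W : Submodule B A := Submodule.span B {1}
  let q : A →ₗ[B] A ⧸ W := W.mkQ
  let N : Submodule B (A ⧸ W) := Submodule.span B {q a}
  have hq1 : q 1 = 0 := (Submodule.Quotient.mk_eq_zero W).2 (Submodule.mem_span_singleton_self 1)
  let v : N := ⟨q a, Submodule.mem_span_singleton_self _⟩
  have hex : Function.Exact (0 : PUnit.{u + 1} →ₗ[B] N) N.subtype := fun y => by
    simp [eq_comm]
  -- In `A ⊗_B (A/B)` one has `1 ⊗ q(a) = a ⊗ q(1) = 0`. Flatness makes `A ⊗_B N → A ⊗_B (A/B)`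
  -- injective, so the vanishing already holds in `A ⊗_B N`.
  have hv : BTensor.tmul B (1 : A) v = 0 := by
    obtain ⟨y, hy⟩ := ((hB _ _ _ _ _).1 hex (BTensor.tmul B (1 : A) v)).1 (by
      have h : BTensor.tmul B a (q 1) = BTensor.tmul B (1 : A) (q a) := congrArg
        (BTensor.map (R := B) (AddMonoidHom.id A) (fun _ _ => rfl) q.toAddMonoidHom q.map_smul) ha
      rw [hq1, BTensor.tmul_zero] at h
      exact h.symm)
    have hy0 : y = 0 := BTensor.eq_zero_of_subsingleton y
    exact hy.symm.trans ((congrArg _ hy0).trans (map_zero _))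
  have hzero : ∀ y : BTensor B A N, y = 0 := fun y => by
    induction y using BTensor.induction_on with
    | zero => rfl
    | tmul m n =>
      obtain ⟨n, hn⟩ := n
      obtain ⟨b, rfl⟩ := Submodule.mem_span_singleton.1 hn
      have h : (⟨b • q a, hn⟩ : N) = b • v := rfl
      have h2 := congrArg (fun y => (m * (b : A)) • y) hv
      rw [h, ← BTensor.op_smul_tmul, subring_op_smul]
      simpa using h2
    | add x y hx hy => rw [hx, hy, add_zero]
  -- Exactness of `0 → N → 0` says `N = 0`; it is reflected from `A ⊗_B N = 0`.
  have hex2 : Function.Exact (0 : PUnit.{u + 1} →ₗ[B] N) (0 : N →ₗ[B] PUnit.{u + 1}) :=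
    (hB _ _ _ _ _).2 fun y => by
      obtain rfl := hzero y
      exact ⟨fun _ => ⟨0, map_zero _⟩, fun _ => map_zero _⟩
  obtain ⟨_, h⟩ := (hex2 v).1 rfl
  have h3 : q a = 0 := congrArg Subtype.val h.symm
  obtain ⟨b, hb⟩ := Submodule.mem_span_singleton.1 ((Submodule.Quotient.mk_eq_zero W).1 h3)
  rw [← hb, Subring.smul_def, smul_eq_mul, mul_one]
  exact b.2

/-! ### Quasibases and the identification of `A ⊗_R T` with `A ⊗_B A`. -/

/-- For a splitting `p ∘ i = id` through `A^n`, take `γ_j(a)` to be the `j`-th coordinate of `i(1 ⊗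
a)` and `u_j = p(e_j)`. The quasibase identity is `p(i(a ⊗ a')) = a ⊗ a'` written in coordinates. -/
theorem IsDepthTwo.exists_isRightD2Quasibase (hB : IsDepthTwo B) :
    ∃ (n : ℕ) (γ : Fin n → bimoduleEnd B) (u : Fin n → centralTensors B),
      IsRightD2Quasibase B γ u := by
  obtain ⟨n, i, p, hi, hp, hpi⟩ := hB.right
  refine ⟨n, fun j => ⟨((Pi.evalAddMonoidHom _ j).comp i).comp (BTensor.mk B A A 1), ?_, ?_⟩,
    fun j => ⟨p (Pi.single j 1), fun b hb => ?_⟩, fun a a' => ?_⟩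
  · intro b a
    have h1 : BTensor.tmul B (1 : A) (b • a) = (b : A) • BTensor.tmul B (1 : A) a := by
      simp [← BTensor.op_smul_tmul]
    simp only [AddMonoidHom.comp_apply, BTensor.mk_apply, h1, hi.map_smul]
    rfl
  · intro b a
    have h1 : BTensor.tmul B (1 : A) (MulOpposite.op b • a) =
      MulOpposite.op b • BTensor.tmul B (1 : A) a := rfl
    simp only [AddMonoidHom.comp_apply, BTensor.mk_apply, h1, hi.map_op_smul]
    rfl
  -- The basis vector satisfies `b e_j = e_j b`, and the bimodule map `p` preserves this, so
  -- `p(e_j)` lies in `T`.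
  · have h2 : MulOpposite.op (⟨b, hb⟩ : B) • (Pi.single j 1 : Fin n → A) =
        b • (Pi.single j 1 : Fin n → A) := by
      ext k
      by_cases hk : k = j
      · subst hk; simp
      · simp [hk]
    rw [← hp.map_smul, ← h2, hp.map_op_smul]
    generalize p (Pi.single j 1) = y
    induction y using BTensor.induction_on with
    | zero => simp
    | tmul m n => rfl
    | add x y hx hy => simp only [smul_add, hx, hy]
  · have h1 : BTensor.tmul B a a' = a • BTensor.tmul B (1 : A) a' := by simp
    have h2 : ∀ f : Fin n → A, p f = ∑ j, f j • p (Pi.single j 1) := fun f => by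
      conv_lhs => rw [← Finset.univ_sum_single f, map_sum]
      refine Finset.sum_congr rfl fun j _ => ?_
      rw [← hp.map_smul]
      congr 1
      ext k
      by_cases hk : k = j
      · subst hk; simp
      · simp [hk]
    rw [← hpi (BTensor.tmul B a a'), h2, h1, hi.map_smul]
    rfl

variable (B) in
/-- The map `A ⊗_R T → A ⊗_B A`, `a ⊗ t ↦ at¹ ⊗ t²`. -/
def galoisToSquare : GaloisModule B →+ TensorSquare B :=
  BTensor.lift
    (AddMonoidHom.mk' (fun a => AddMonoidHom.mk' (fun t => a • (t : TensorSquare B))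
        (fun _ _ => by simp))
      (fun _ _ => by ext; simp [add_smul]))
    (fun r a t => by
      change (a * (r : A)) • (t : TensorSquare B) = a • ((r : A) • (t : TensorSquare B))
      rw [mul_smul])

@[simp] theorem galoisToSquare_tmul (a : A) (t : centralTensors B) :
    galoisToSquare B (BTensor.tmul _ a t) = a • (t : TensorSquare B) := rfl

theorem galoisToSquare_smul (a : A) (c : GaloisModule B) :
    galoisToSquare B (a • c) = a • galoisToSquare B c := by
  induction c using BTensor.induction_on with
  | zero => simp
  | tmul m n => simp [mul_smul]
  | add x y hx hy => simp only [smul_add, map_add, hx, hy]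

theorem IsRightD2Quasibase.galoisToSquare_coaction {n : ℕ} {γ : Fin n → bimoduleEnd B}
    {u : Fin n → centralTensors B} (h : IsRightD2Quasibase B γ u) (a : A) :
    galoisToSquare B (coaction γ u a) = BTensor.tmul B 1 a := by
  rw [h]
  simp [coaction]

/-- For `γ ∈ S`, the map `A ⊗_B A → A`, `a ⊗ a' ↦ aγ(a')`. -/
def mulApplyRight (γ : bimoduleEnd B) : TensorSquare B →+ A :=
  (sweedlerCounit B).comp (centralTensors.idTensor γ)

@[simp] theorem mulApplyRight_tmul (γ : bimoduleEnd B) (a a' : A) :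
    mulApplyRight γ (BTensor.tmul B a a') = a * (γ : A →+ A) a' := rfl

theorem mulApplyRight_smul (γ : bimoduleEnd B) (a : A) (y : TensorSquare B) :
    mulApplyRight γ (a • y) = a * mulApplyRight γ y := by
  induction y using BTensor.induction_on with
  | zero => simp
  | tmul m n => simp [mul_assoc]
  | add x y hx hy => simp only [smul_add, map_add, hx, hy, mul_add]

theorem IsRightD2Quasibase.eq_sum {n : ℕ} {γ : Fin n → bimoduleEnd B}
    {u : Fin n → centralTensors B} (h : IsRightD2Quasibase B γ u) (y : TensorSquare B) :
    y = ∑ j, mulApplyRight (γ j) y • (u j : TensorSquare B) := by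
  induction y using BTensor.induction_on with
  | zero => simp
  | tmul m n => exact h m n
  | add x y hx hy =>
    conv_lhs => rw [hx, hy]
    simp only [map_add, add_smul, Finset.sum_add_distrib]

/-- The inverse records the coefficients of the quasibase expansion `y = ∑ y¹γ_j(y²) u_j`. -/
theorem IsRightD2Quasibase.galoisToSquare_bijective {n : ℕ} {γ : Fin n → bimoduleEnd B}
    {u : Fin n → centralTensors B} (h : IsRightD2Quasibase B γ u) :
    Function.Bijective (galoisToSquare B) := by
  let s (y : TensorSquare B) : GaloisModule B :=
    ∑ j, BTensor.tmul (centralizerRing B) (mulApplyRight (γ j) y) (u j)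
  refine Function.bijective_iff_has_inverse.2 ⟨s, fun c => ?_, fun y => ?_⟩
  · induction c using BTensor.induction_on with
    | zero => simp [s, BTensor.zero_tmul]
    | tmul a t =>
      -- For `t ∈ T` the coefficients `t¹γ_j(t²)` are values of `ε_T`, hence lie in `R` and may
      -- cross `⊗_R`.
      have h1 : t = ∑ j, centralTensors.counit (centralTensors.applyRight (γ j) t) • u j := by
        apply centralTensors.ext
        rw [AddSubgroup.val_finsetSum]
        exact h.eq_sum t
      conv_rhs => rw [h1, ← BTensor.mk_apply (R := centralizerRing B), map_sum]
      refine Finset.sum_congr rfl fun j _ => ?_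
      rw [galoisToSquare_tmul, mulApplyRight_smul, BTensor.mk_apply, ← BTensor.op_smul_tmul]
      rfl
    | add x y hx hy =>
      conv_rhs => rw [← hx, ← hy]
      simp only [s, map_add, BTensor.add_tmul, Finset.sum_add_distrib]
  · simpa [s] using (h.eq_sum y).symm

variable (B) in
/-- The map `T ⊗_R T → (A ⊗_B A) ⊗_A (A ⊗_B A)` induced by the inclusion of `T`. -/
def centralTensorsToSquare :
    BTensor (centralizerRing B) (centralTensors B) (centralTensors B) →+
      BTensor A (TensorSquare B) (TensorSquare B) :=
  BTensor.lift
    (((BTensor.mk A (TensorSquare B) (TensorSquare B)).compl₂ (centralTensors B).subtype).comp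
      (centralTensors B).subtype)
    (fun r s t => BTensor.op_smul_tmul (r : A) (s : TensorSquare B) (t : TensorSquare B))

@[simp] theorem centralTensorsToSquare_tmul (s t : centralTensors B) :
    centralTensorsToSquare B (BTensor.tmul _ s t) =
      BTensor.tmul A (s : TensorSquare B) (t : TensorSquare B) := rfl

theorem IsRightD2Quasibase.centralTensorsToSquare_comul {n : ℕ} {γ : Fin n → bimoduleEnd B}
    {u : Fin n → centralTensors B} (h : IsRightD2Quasibase B γ u) (t : centralTensors B) :
    centralTensorsToSquare B (centralTensors.comul γ u t) = sweedlerComul B t := by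
  -- The identity is proved on all of `A ⊗_B A`, where it can be tested on simple tensors; elements
  -- of `T` need not be sums of simple tensors lying in `T`.
  have key : ∀ y : TensorSquare B,
      ∑ j, BTensor.tmul A (centralTensors.idTensor (γ j) y) (u j : TensorSquare B) =
        sweedlerComul B y := fun y => by
    induction y using BTensor.induction_on with
    | zero => simp [BTensor.zero_tmul]
    | tmul a a' =>
      -- Only the second factor is expanded, `1 ⊗ a' = ∑ γ_j(a')u_j`; then `γ_j(a')` crosses `⊗_A`
      -- and turns `a ⊗ 1` into `a ⊗ γ_j(a')`.
      rw [sweedlerComul_tmul, h 1 a', ← BTensor.mk_apply (R := A), map_sum]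
      refine Finset.sum_congr rfl fun j _ => ?_
      rw [BTensor.mk_apply, ← BTensor.op_smul_tmul, centralTensors.idTensor_tmul]
      simp
    | add x y hx hy => simp only [map_add, BTensor.add_tmul, Finset.sum_add_distrib, hx, hy]
  rw [← key]
  simp only [centralTensors.comul, map_sum, centralTensorsToSquare_tmul]
  rfl

end Extensions

/-! ### The Galois coring of a depth two extension. -/

theorem mainTheorem1 {A : Type u} [Ring A] (B : Subring A) (hB : IsDepthTwo B) :
    (∃ (n : ℕ) (γ : Fin n → bimoduleEnd B) (u : Fin n → centralTensors B),
      IsRightD2Quasibase B γ u) ∧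
    ∃ (_ : Module Aᵐᵒᵖ (GaloisModule B)) (_ : SMulCommClass A Aᵐᵒᵖ (GaloisModule B))
      (𝒞 : Coring A (GaloisModule B)),
      -- the canonical structure, computed from any right D2 quasibase
      (∀ (n : ℕ) (γ : Fin n → bimoduleEnd B) (u : Fin n → centralTensors B),
        IsRightD2Quasibase B γ u →
          -- `(a ⊗ t) a' = a a'₍₀₎ ⊗ t a'₍₁₎`
          (∀ (a a' : A) (t : centralTensors B) (k : ℕ) (p : Fin k → A)
            (q : Fin k → centralTensors B),
            coaction γ u a' = ∑ i, BTensor.tmul (centralizerRing B) (p i) (q i) →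
            MulOpposite.op a' • BTensor.tmul (centralizerRing B) a t =
              ∑ i, BTensor.tmul (centralizerRing B) (a * p i) (t * q i)) ∧
          -- `Δ(a ⊗ t) = (a ⊗ t₍₁₎) ⊗ (1 ⊗ t₍₂₎)`
          (∀ (a : A) (t : centralTensors B) (k : ℕ) (p q : Fin k → centralTensors B),
            centralTensors.comul γ u t =
              ∑ i, BTensor.tmul (centralizerRing B) (p i) (q i) →
            𝒞.comul (BTensor.tmul (centralizerRing B) a t) =
              ∑ i, BTensor.tmul A (BTensor.tmul (centralizerRing B) a (p i))
                (BTensor.tmul (centralizerRing B) (1 : A) (q i)))) ∧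
      -- `ε(a ⊗ t) = a ε_T(t)`
      (∀ (a : A) (t : centralTensors B),
        𝒞.counit (BTensor.tmul (centralizerRing B) a t) = a * (centralTensors.counit t : A)) ∧
      -- `1 ⊗ 1` is grouplike and `(C, 1 ⊗ 1)` is a Galois coring
      𝒞.IsGalois (BTensor.tmul (centralizerRing B) (1 : A) (1 : centralTensors B)) ∧
      -- `can : A ⊗_B A → C` is an isomorphism of corings
      (∃ h : B ≤ coinvariants A
          (BTensor.tmul (centralizerRing B) (1 : A) (1 : centralTensors B)),
        IsCoringHom (sweedlerCoring B) 𝒞 (can _ B h) ∧ Function.Bijective (can _ B h)) ∧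
      (IsBalancedModule B A ∨ IsFaithfullyFlatModule B A →
        coinvariants A (BTensor.tmul (centralizerRing B) (1 : A) (1 : centralTensors B)) = B) := by
  obtain ⟨n₀, γ₀, u₀, h₀⟩ := hB.exists_isRightD2Quasibase
  let β : GaloisModule B ≃+ TensorSquare B :=
    AddEquiv.ofBijective (galoisToSquare B) h₀.galoisToSquare_bijective
  have hβ_smul (a : A) (c : GaloisModule B) : β (a • c) = a • β c := galoisToSquare_smul a c
  have hβ_tmul (a : A) (t : centralTensors B) :
      β (BTensor.tmul _ a t) = a • (t : TensorSquare B) := rfl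
  -- β is already left linear; the right action is defined so that β becomes a bimodule map.
  let _ : Module Aᵐᵒᵖ (GaloisModule B) := β.module Aᵐᵒᵖ
  have hβ_op (a : Aᵐᵒᵖ) (c : GaloisModule B) : β (a • c) = a • β c :=
    β.apply_symm_apply (a • β c)
  have : SMulCommClass A Aᵐᵒᵖ (GaloisModule B) :=
    ⟨fun a a' c => β.injective <| by simp only [hβ_smul, hβ_op, smul_comm]⟩
  have hsymm : IsBimoduleHom A A (β.symm : TensorSquare B →+ GaloisModule B) :=
    IsBimoduleHom.symm (e := β) ⟨hβ_smul, fun a c => hβ_op (.op a) c⟩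
  let 𝒞 : Coring A (GaloisModule B) := (sweedlerCoring B).ofEquiv β.symm hsymm
  have hcomul (c : GaloisModule B) : 𝒞.comul c = Coring.mapSquare hsymm (sweedlerComul B (β c)) := by
    conv_lhs => rw [← β.symm_apply_apply c]
    exact Coring.ofEquiv_comul _ _ hsymm _
  have hcounit (c : GaloisModule B) : 𝒞.counit c = sweedlerCounit B (β c) := rfl
  have hβsymm (a : A) (t : centralTensors B) :
      β.symm (a • (t : TensorSquare B)) = BTensor.tmul _ a t := by
    rw [← hβ_tmul, β.symm_apply_apply]
  let x : GaloisModule B := BTensor.tmul (centralizerRing B) (1 : A) (1 : centralTensors B)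
  have hx : β x = BTensor.tmul B (1 : A) (1 : A) :=
    one_smul A (BTensor.tmul B (1 : A) (1 : A))
  have hx' : β.symm (BTensor.tmul B (1 : A) (1 : A)) = x := by rw [← hx, β.symm_apply_apply]
  have hmem (a : A) : a ∈ coinvariants A x ↔ BTensor.tmul B a (1 : A) = BTensor.tmul B 1 a := by
    rw [mem_coinvariants_iff, ← β.injective.eq_iff, hβ_smul, hβ_op, hx]
    simp
  have hle : B ≤ coinvariants A x := fun b hb => (hmem b).2 (tmul_one_eq_one_tmul_of_mem hb)
  have hgl : 𝒞.IsGrouplike x :=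
    ⟨by rw [hcomul, hx, sweedlerComul_tmul, Coring.mapSquare_tmul]
        simp only [AddMonoidHom.coe_coe, hx'],
      by rw [hcounit, hx, sweedlerCounit_tmul, one_mul]⟩
  -- Both are bimodule maps sending `1 ⊗ 1` to `x`, and `1 ⊗ 1` generates `A ⊗_B A`.
  have hcan (y : TensorSquare B) : can x B hle y = β.symm y := by
    refine DFunLike.congr_fun (f := can x B hle) (g := (β.symm : TensorSquare B →+ _))
      (BTensor.hom_ext fun a a' => ?_) y
    rw [can_tmul, ← hx', ← AddMonoidHom.coe_coe β.symm, ← hsymm.map_op_smul, ← hsymm.map_smul]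
    simp
  have hbij : Function.Bijective (can x B hle) := by
    rw [show ⇑(can x B hle) = ⇑β.symm from funext hcan]
    exact β.symm.bijective
  refine ⟨⟨n₀, γ₀, u₀, h₀⟩, inferInstance, inferInstance, 𝒞, fun n γ u h => ⟨?_, ?_⟩, ?_,
    ⟨hgl, hgl.isCoringHom_can _ _, can_bijective_of_le hle le_rfl hbij⟩,
    ⟨hle, hgl.isCoringHom_can _ _, hbij⟩, fun hBA => le_antisymm (fun a ha => ?_) hle⟩
  · intro a a' t k p q hpq
    apply β.injective
    -- Under β, `(a ⊗ t)a'` becomes `a t a'`, the image of `1 ⊗ a' = β(ρ(a'))` under `y ↦ a y¹ t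
    -- y²`. As this depends only on `ρ(a')`, any expansion `∑ p_i ⊗ q_i` may be used.
    have h1 := congrArg (fun c => a • centralTensors.insert t (β c)) hpq
    have h2 : β (coaction γ u a') = _ := h.galoisToSquare_coaction a'
    simp only [h2, map_sum, hβ_tmul, centralTensors.insert_smul, Finset.smul_sum,
      centralTensors.insert_tmul, one_smul] at h1
    rw [hβ_op, hβ_tmul, map_sum, ← smul_comm, h1]
    simp only [hβ_tmul, mul_smul, centralTensors.coe_mul]
  · intro a t k p q hpq
    -- Applied to `Δ_T(t)`, this additive map yields `Δ(a ⊗ t)`; applied to the expansion, it yields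
    -- the claimed sum.
    have h1 := congrArg (fun y => Coring.mapSquare hsymm (a • centralTensorsToSquare B y)) hpq
    simp only [h.centralTensorsToSquare_comul, map_sum, centralTensorsToSquare_tmul,
      Finset.smul_sum, BTensor.smul_tmul, Coring.mapSquare_tmul, AddMonoidHom.coe_coe,
      hβsymm] at h1
    rw [hcomul, hβ_tmul, (sweedlerComul_bimodule B).map_smul, h1]
    refine Finset.sum_congr rfl fun i _ => ?_
    rw [← hβsymm 1, one_smul]
  · intro a t
    rw [hcounit, hβ_tmul, (sweedlerCounit_bimodule B).map_smul]
    rfl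
  · have ha' := (hmem a).1 ha
    rcases hBA with hBA | hBA
    · exact mem_of_tmul_eq_of_isBalancedModule hBA ha'
    · exact mem_of_tmul_eq_of_isFaithfullyFlatModule hBA ha'
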